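/- An alphabet is a finite set of letters, and a sequence is a map from $\mathbb N$ to an alphabet. A substitution $\tau=(\tau,B,b)$ consists of an alphabet $B$, a map $\tau$ from $B$ to the non-empty finite words on $B$ (extended by concatenation to words and sequences on $B$), and a letter $b\in B$ which is the first letter of $\tau(b)$. Its matrix $M_\tau$ has as entry $(i,j)$ the number of occurrences of the letter $i$ in the word $\tau(j)$, and $\tau$ is primitive if some power of $M_\tau$ has only positive entries. A fixed point of $\tau$ is a sequence $Y$ on $B$ with $Y_0=b$ and $\tau(Y)=Y$ (it is unique if $\tau$ is primitive). A sequence $X$ on an alphabet $A$ arises from $\tau$ if $X=(\phi(Y_n))_{n\ge 0}$ for a fixed point $Y$ of $\tau$ and a map $\phi:B\to A$. The dominant eigenvalue of $M_\tau$ is its non-negative real eigenvalue $r$ such that every complex eigenvalue of $M_\tau$ has modulus at most $r$. Theorem. Let $\tau=(\tau,B,b)$ and $\sigma=(\sigma,C,c)$ be primitive substitutions, and let $X$ be a sequence on an alphabet $A$ which arises from $\tau$ and also from $\sigma$. Suppose that $X$ is not ultimately periodic, that is, there are no $N\ge 0$ and $p\ge 1$ with $X_{n+p}=X_n$ for all $n\ge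 N$. Then the dominant eigenvalues $\alpha$ of $M_\tau$ and $\beta$ of $M_\sigma$ are multiplicatively dependent: there are integers $k,l\ge 1$ with $\alpha^k=\beta^l$. -/

import Mathlib

/-- The sequence `X` is ultimately periodic: `X = u v v v ⋯` with `u` of length `N` and
`v` of length `p > 0`. -/
def UltimatelyPeriodic {A : Type*} (X : ℕ → A) : Prop :=
  ∃ N p : ℕ, 0 < p ∧ ∀ n, N ≤ n → X (n + p) = X n

/-- The prefix `X₀ X₁ ⋯ Xₙ₋₁` of length `n` of a sequence. -/
def seqPrefix {A : Type*} (X : ℕ → A) (n : ℕ) : List A :=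
  (List.range n).map X

/-- A substitution on the alphabet `A`: a map `A → A⁺` (extended to words by concatenation),
with a distinguished letter `start` which is the first letter of its own image. -/
structure Substitution (A : Type*) where
  toFun : A → List A
  start : A
  ne_nil : ∀ b, toFun b ≠ []
  head_start : (toFun start).head? = some start

namespace Substitution

/-- The image of a word: the concatenation of the images of its letters. -/
def onWord {A : Type*} (τ : Substitution A) (w : List A) : List A :=
  w.flatMap τ.toFun

theorem length_le_onWord {A : Type*} (τ : Substitution A) (w : List A) :
    w.length ≤ (τ.onWord w).length := by
  induction w with
  | nil => simp
  | cons b w ih =>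
    have h := List.length_pos_iff.mpr (τ.ne_nil b)
    simp only [onWord, List.flatMap_cons, List.length_append, List.length_cons] at ih ⊢
    omega

/-- The image `τ(X₀) τ(X₁) τ(X₂) ⋯` of a sequence. Since every `τ(Xᵢ)` is non-empty, its `n`-th
letter can be read off in the word `τ(X₀ ⋯ Xₙ)`. -/
def onSeq {A : Type*} (τ : Substitution A) (X : ℕ → A) : ℕ → A := fun n =>
  (τ.onWord (seqPrefix X (n + 1)))[n]'(by
    have h := τ.length_le_onWord (seqPrefix X (n + 1))
    simp only [seqPrefix, List.length_map, List.length_range] at h ⊢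
    omega)

/-- `X` is the fixed point of `τ`: it begins with the distinguished letter and `τ(X) = X`. -/
def IsFixedPoint {A : Type*} (τ : Substitution A) (X : ℕ → A) : Prop :=
  X 0 = τ.start ∧ τ.onSeq X = X

/-- The matrix of `τ`: the entry `(i, j)` is the number of occurrences of `i` in `τ(j)`. -/
def matrix {A : Type*} [DecidableEq A] (τ : Substitution A) : Matrix A A ℝ :=
  Matrix.of fun i j => ((τ.toFun j).count i : ℝ)

/-- `τ` is primitive: some power of its matrix has only positive entries. -/
def IsPrimitive {A : Type*} [Fintype A] [DecidableEq A] (τ : Substitution A) : Prop :=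
  τ.matrix.IsPrimitive

end Substitution

/-- `X` arises from `τ`: it is the image of the fixed point of `τ` under a letter-to-letter
morphism. -/
def ArisesFrom {A B : Type*} (X : ℕ → A) (τ : Substitution B) : Prop :=
  ∃ (Y : ℕ → B) (φ : B → A), τ.IsFixedPoint Y ∧ X = φ ∘ Y

/-- `r` is the dominant eigenvalue of the real square matrix `M`: a non-negative real eigenvalue
such that every complex eigenvalue has modulus at most `r`. -/
def IsDominantEigenvalue {A : Type*} [Fintype A] [DecidableEq A] (M : Matrix A A ℝ) (r : ℝ) :
    Prop :=
  0 ≤ r ∧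
    Module.End.HasEigenvalue (Matrix.toLin' (M.map (fun x : ℝ => (x : ℂ)))) (r : ℂ) ∧
    ∀ z : ℂ, Module.End.HasEigenvalue (Matrix.toLin' (M.map (fun x : ℝ => (x : ℂ)))) z → ‖z‖ ≤ r

/-- Two real numbers are multiplicatively dependent: they have a common positive power. -/
def MultiplicativelyDependent (α β : ℝ) : Prop :=
  ∃ k l : ℕ, 0 < k ∧ 0 < l ∧ α ^ k = β ^ l

/-! How densely the prefixes of `X` recur depends on `X` alone, while each substitution prescribes
this density up to finitely many values and a power of its eigenvalue. Let F(n) be the upper density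
of the occurrences of the prefix of length n. Cut the fixed point of `τ` into the images of its
letters under τ^k, with k = k(n) chosen so that every block has length at least n and O(n); this is
possible because all these lengths are comparable to α^k. An occurrence starting in a block ends
there or in the next one, so the number of those starting in it depends only on two consecutive
letters. This number is bounded independently of n: by linear recurrence, two occurrences at a
distance much smaller than n would make `X` periodic. Hence α^k F(n), an upper mean per block, lies
in a finite set independent of n (`IsSelfSimilar.exists_finite_upperSlope_prefixCount`).

The same holds for `σ` with β^l F(n). By the pigeonhole principle some n and n' share both values
while both exponents are larger for n', so α^(k'-k) = F(n)/F(n') = β^(l'-l).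

Perron–Frobenius theory supplies block lengths comparable to α^k and of mean α^k
(`Substitution.IsFixedPoint.isSelfSimilar`). Upper slopes replace frequencies, so no limit density
has to exist; `upperSlope_comp` gives their scaling. -/

open Filter Topology
open scoped Matrix

/-! ### Perron–Frobenius: a positive left eigenvector -/

section Perron

variable {B : Type*} [Fintype B]

theorem vecMul_le_vecMul_of_le {M : Matrix B B ℝ} (hM : ∀ i j, 0 ≤ M i j) {x y : B → ℝ}
    (h : ∀ i, x i ≤ y i) (j : B) : (x ᵥ* M) j ≤ (y ᵥ* M) j :=
  Finset.sum_le_sum fun i _ => mul_le_mul_of_nonneg_right (h i) (hM i j)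

theorem vecMul_pos_of_pos {M : Matrix B B ℝ} (hM : ∀ i j, 0 < M i j) {x : B → ℝ}
    (h : ∀ i, 0 ≤ x i) (hx : x ≠ 0) (j : B) : 0 < (x ᵥ* M) j := by
  obtain ⟨i, hi⟩ := Function.ne_iff.mp hx
  exact Finset.sum_pos' (fun i _ => mul_nonneg (h i) (hM i j).le)
    ⟨i, Finset.mem_univ i, mul_pos (lt_of_le_of_ne (h i) (Ne.symm hi)) (hM i j)⟩

variable [DecidableEq B]

attribute [local instance] Matrix.linftyOpNormedRing Matrix.linftyOpNormedAlgebra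
  Matrix.linftyOpNormedAddCommGroup Matrix.linftyOpNormedSpace

/-- The sum of a row is at most the operator norm. -/
theorem row_sum_le_norm_map_ofReal (M : Matrix B B ℝ) (i : B) :
    ∑ j, M i j ≤ ‖M.map (fun x : ℝ => (x : ℂ))‖ := by
  rw [Matrix.linfty_opNorm_def]
  have h : (∑ j, ‖(M.map (fun x : ℝ => (x : ℂ))) i j‖₊) ≤
      Finset.univ.sup fun i => ∑ j, ‖(M.map (fun x : ℝ => (x : ℂ))) i j‖₊ :=
    Finset.le_sup (f := fun i => ∑ j, ‖(M.map (fun x : ℝ => (x : ℂ))) i j‖₊) (Finset.mem_univ i)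
  refine le_trans ?_ (NNReal.coe_le_coe.mpr h)
  push_cast
  refine Finset.sum_le_sum fun j _ => ?_
  simpa using le_abs_self (M i j)

/-- If every eigenvalue has modulus less than `s`, the powers of the matrix are eventually smaller
than those of `s`. -/
theorem eventually_norm_pow_lt [Nonempty B] (M : Matrix B B ℂ) (s : ℝ)
    (h : ∀ z : ℂ, Module.End.HasEigenvalue (Matrix.toLin' M) z → ‖z‖ < s) :
    ∃ n : ℕ, ‖M ^ n‖ < s ^ n := by
  have : CompleteSpace (Matrix B B ℂ) := FiniteDimensional.complete ℂ _
  have hspec : ∀ z ∈ spectrum ℂ M, ‖z‖ < s := fun z hz => by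
    refine h z ?_
    rw [Module.End.hasEigenvalue_iff_mem_spectrum, Matrix.spectrum_toLin']
    exact hz
  obtain ⟨z₀, hz₀⟩ := spectrum.nonempty M
  have hs : 0 < s := (norm_nonneg z₀).trans_lt (hspec z₀ hz₀)
  lift s to NNReal using hs.le
  have hr : spectralRadius ℂ M < s :=
    spectrum.spectralRadius_lt_of_forall_lt M fun z hz => by
      have := hspec z hz
      exact_mod_cast this
  have hev := (spectrum.pow_nnnorm_pow_one_div_tendsto_nhds_spectralRadius M).eventually_lt_const hr
  obtain ⟨n, hn, hn0⟩ := (hev.and (eventually_gt_atTop 0)).exists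
  refine ⟨n, ?_⟩
  have hn0' : (0 : ℝ) < n := by exact_mod_cast hn0
  have h2 := ENNReal.rpow_lt_rpow hn hn0'
  rw [← ENNReal.rpow_mul, one_div, inv_mul_cancel₀ hn0'.ne', ENNReal.rpow_one,
    ENNReal.rpow_natCast] at h2
  have h3 : ‖M ^ n‖₊ < s ^ n := by exact_mod_cast h2
  exact_mod_cast h3

theorem pow_smul_le_vecMul_pow {M : Matrix B B ℝ} (hM : ∀ i j, 0 ≤ M i j) {y : B → ℝ} {s : ℝ}
    (hs : 0 ≤ s) (h : ∀ j, s * y j ≤ (y ᵥ* M) j) (n : ℕ) (j : B) :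
    s ^ n * y j ≤ (y ᵥ* M ^ n) j := by
  induction n generalizing j with
  | zero => simp
  | succ n ih =>
    have h1 := vecMul_le_vecMul_of_le hM (x := s ^ n • y) (y := y ᵥ* M ^ n) (by simpa using ih) j
    rw [Matrix.smul_vecMul, Matrix.vecMul_vecMul, ← pow_succ] at h1
    refine le_trans ?_ h1
    have := mul_le_mul_of_nonneg_left (h j) (pow_nonneg hs n)
    simp only [Pi.smul_apply, smul_eq_mul]
    linarith [this, pow_succ s n, show s ^ (n + 1) * y j = s ^ n * (s * y j) by ring]

/-- A nonnegative matrix which expands a positive row vector by the factor `s` has an eigenvalue of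
modulus at least `s`. -/
theorem exists_hasEigenvalue_le_norm [Nonempty B] {M : Matrix B B ℝ} (hM : ∀ i j, 0 ≤ M i j)
    {y : B → ℝ} {s : ℝ} (hs : 0 ≤ s) (hy : ∀ i, 0 < y i) (h : ∀ j, s * y j ≤ (y ᵥ* M) j) :
    ∃ z : ℂ, Module.End.HasEigenvalue (Matrix.toLin' (M.map (fun x : ℝ => (x : ℂ)))) z ∧
      s ≤ ‖z‖ := by
  by_contra! hcon
  -- Summing `s ^ n * y ≤ y ᵥ* M ^ n` over the coordinates forces the row-sum norm of `M ^ n` to be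
  -- at least `s ^ n`, a contradiction.
  obtain ⟨n, hn⟩ := eventually_norm_pow_lt _ s hcon
  have hmap : (M.map (fun x : ℝ => (x : ℂ))) ^ n = (M ^ n).map (fun x : ℝ => (x : ℂ)) :=
    (Matrix.map_pow M (Complex.ofRealHom) n).symm
  rw [hmap] at hn
  have hpos : 0 < ∑ i, y i := Finset.sum_pos (fun i _ => hy i) Finset.univ_nonempty
  have h1 : s ^ n * ∑ j, y j ≤ ∑ j, (y ᵥ* M ^ n) j := by
    rw [Finset.mul_sum]
    exact Finset.sum_le_sum fun j _ => pow_smul_le_vecMul_pow hM hs h n j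
  have h2 : ∑ j, (y ᵥ* M ^ n) j = ∑ i, y i * ∑ j, (M ^ n) i j := by
    simp only [Matrix.vecMul, dotProduct, Finset.mul_sum]
    exact Finset.sum_comm
  have h3 : ∑ i, y i * ∑ j, (M ^ n) i j ≤
      ∑ i, y i * ‖(M ^ n).map (fun x : ℝ => (x : ℂ))‖ :=
    Finset.sum_le_sum fun i _ =>
      mul_le_mul_of_nonneg_left (row_sum_le_norm_map_ofReal _ i) (hy i).le
  rw [← Finset.sum_mul] at h3
  nlinarith

/-- A real eigenvalue has a left eigenvector. -/
theorem exists_left_eigenvector {M : Matrix B B ℝ} {α : ℝ}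
    (h : Module.End.HasEigenvalue (Matrix.toLin' (M.map (fun x : ℝ => (x : ℂ)))) (α : ℂ)) :
    ∃ x : B → ℝ, x ≠ 0 ∧ x ᵥ* M = α • x := by
  rw [Module.End.hasEigenvalue_iff_mem_spectrum, Matrix.spectrum_toLin', spectrum.mem_iff,
    Matrix.isUnit_iff_isUnit_det, isUnit_iff_ne_zero, not_not] at h
  have h0 : algebraMap ℂ (Matrix B B ℂ) (α : ℂ) - M.map (fun x : ℝ => (x : ℂ)) =
      (Complex.ofRealHom).mapMatrix (algebraMap ℝ (Matrix B B ℝ) α - M) := by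
    ext i j
    simp [Matrix.algebraMap_matrix_apply]
    split_ifs <;> simp
  rw [h0, ← RingHom.map_det, map_eq_zero] at h
  obtain ⟨x, hx, hx0⟩ := Matrix.exists_vecMul_eq_zero_iff.mpr h
  refine ⟨x, hx, ?_⟩
  rw [Matrix.vecMul_sub, sub_eq_zero] at hx0
  rw [← hx0, Algebra.algebraMap_eq_smul_one, Matrix.vecMul_smul, Matrix.vecMul_one]

/-- The dominant eigenvalue of a primitive matrix has a positive left eigenvector. -/
theorem IsDominantEigenvalue.exists_pos_left_eigenvector [Nonempty B] {M : Matrix B B ℝ}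
    (hM : M.IsPrimitive) {α : ℝ} (hα : IsDominantEigenvalue M α) :
    0 < α ∧ ∃ l : B → ℝ, (∀ i, 0 < l i) ∧ l ᵥ* M = α • l := by
  obtain ⟨h0, heig, hmax⟩ := hα
  obtain ⟨p, hp0, hp⟩ := hM.exists_pos_pow
  obtain ⟨x, hx, hxM⟩ := exists_left_eigenvector heig
  set l : B → ℝ := fun i => |x i| with hl
  have hl0 : ∀ i, 0 ≤ l i := fun i => abs_nonneg _
  have hlne : l ≠ 0 := fun h => hx <| funext fun i => abs_eq_zero.mp (congrFun h i)
  have hle : ∀ j, α * l j ≤ (l ᵥ* M) j := fun j => by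
    have h1 : α * x j = (x ᵥ* M) j := by rw [hxM]; simp
    calc α * l j = |α * x j| := by rw [abs_mul, abs_of_nonneg h0]
      _ = |∑ i, x i * M i j| := by rw [h1]; rfl
      _ ≤ ∑ i, |x i * M i j| := Finset.abs_sum_le_sum_abs _ _
      _ = (l ᵥ* M) j := by
        refine Finset.sum_congr rfl fun i _ => ?_
        rw [abs_mul, abs_of_nonneg (hM.nonneg i j)]
  have hy : ∀ j, 0 < (l ᵥ* M ^ p) j := vecMul_pos_of_pos hp hl0 hlne
  -- If the nonnegative vector `l ᵥ* M - α • l` were nonzero, `M ^ p` would make it positive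
  -- everywhere. Then `y = l ᵥ* M ^ p` would be expanded by its least ratio, which exceeds `α`, and
  -- some eigenvalue would have modulus above `α`.
  have heq : l ᵥ* M = α • l := by
    by_contra hne
    have hz := vecMul_pos_of_pos hp (x := l ᵥ* M - α • l)
      (fun i => by simpa using hle i) (sub_ne_zero.mpr hne)
    set y := l ᵥ* M ^ p with hydef
    have hz' : ∀ j, α * y j < (y ᵥ* M) j := fun j => by
      have := hz j
      rw [Matrix.sub_vecMul, Matrix.smul_vecMul, Matrix.vecMul_vecMul, ← pow_succ', pow_succ,
        ← Matrix.vecMul_vecMul] at this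
      simpa [hydef] using this
    obtain ⟨b, hb⟩ := Finite.exists_min fun j => (y ᵥ* M) j / y j
    have hsα : α < (y ᵥ* M) b / y b := (lt_div_iff₀ (hy b)).mpr (hz' b)
    obtain ⟨z, hz1, hz2⟩ := exists_hasEigenvalue_le_norm hM.nonneg (h0.trans hsα.le) hy
      (fun j => (le_div_iff₀ (hy j)).mp (hb j))
    exact absurd (hmax z hz1) (not_le.mpr (hsα.trans_le hz2))
  have hpow : ∀ n : ℕ, l ᵥ* M ^ n = α ^ n • l := fun n => by
    induction n with
    | zero => simp
    | succ n ih => rw [pow_succ, ← Matrix.vecMul_vecMul, ih, Matrix.smul_vecMul, heq, smul_smul,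
        ← pow_succ]
  have hpos : ∀ j, 0 < α ^ p * l j := fun j => by
    have := hy j
    rw [hpow] at this
    simpa using this
  have hlpos : ∀ j, 0 < l j := fun j =>
    lt_of_le_of_ne (hl0 j) fun h => by simpa [← h] using hpos j
  refine ⟨lt_of_le_of_ne h0 fun h => ?_, l, hlpos, heq⟩
  obtain ⟨b⟩ := ‹Nonempty B›
  have h1 := hpos b
  rw [← h, zero_pow hp0.ne', zero_mul] at h1
  exact h1.false

end Perron

/-! ### Convergence of normalised column sums -/

section Averages

variable {B : Type*} [Fintype B]

/-- An average which gives every point a weight at least `δ` is separated from the maximum. -/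
theorem sum_mul_le_of_weights [Nonempty B] {w h : B → ℝ} {δ u l : ℝ} (hδ : ∀ i, δ ≤ w i)
    (hw : ∑ i, w i = 1) (hw0 : ∀ i, 0 ≤ w i) (hu : ∀ i, h i ≤ u) (hl : ∃ i, h i = l) :
    ∑ i, w i * h i ≤ u - δ * (u - l) := by
  obtain ⟨i₀, hi₀⟩ := hl
  have h1 : ∑ i, w i * (u - h i) ≥ w i₀ * (u - h i₀) :=
    Finset.single_le_sum (f := fun i => w i * (u - h i))
      (fun i _ => mul_nonneg (hw0 i) (sub_nonneg.mpr (hu i))) (Finset.mem_univ i₀)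
  have h2 : ∑ i, w i * (u - h i) = u - ∑ i, w i * h i := by
    simp only [mul_sub, Finset.sum_sub_distrib, ← Finset.sum_mul, hw, one_mul]
  have h3 : δ * (u - h i₀) ≤ w i₀ * (u - h i₀) :=
    mul_le_mul_of_nonneg_right (hδ i₀) (sub_nonneg.mpr (hu i₀))
  rw [hi₀] at h1 h3
  linarith

/-- Iterated averages, with weights bounded below every `p` steps, converge to a constant. -/
theorem exists_tendsto_of_weights [Nonempty B] {h : ℕ → B → ℝ} {w : ℕ → B → B → ℝ} {p : ℕ}
    {δ : ℝ} (hδ0 : 0 < δ) (hw : ∀ q b, ∑ i, w q b i = 1) (hw0 : ∀ q b i, 0 ≤ w q b i)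
    (hδ : ∀ b i, δ ≤ w p b i) (hrec : ∀ k q b, h (k + q) b = ∑ i, w q b i * h k i) :
    ∃ c, ∀ b, Tendsto (fun k => h k b) atTop (𝓝 c) := by
  choose U hU using fun k => Finite.exists_max (h k)
  choose D hD using fun k => Finite.exists_min (h k)
  -- With the weight bound 0, the estimate says that an average is at most the maximum.
  have hup : ∀ k q b, h (k + q) b ≤ h k (U k) := fun k q b => by
    rw [hrec]
    simpa using sum_mul_le_of_weights (hw0 q b) (hw q b) (hw0 q b) (hU k) ⟨U k, rfl⟩
  have hdown : ∀ k q b, h k (D k) ≤ h (k + q) b := fun k q b => by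
    rw [hrec]
    have := sum_mul_le_of_weights (h := fun i => - h k i) (hw0 q b) (hw q b) (hw0 q b)
      (u := - h k (D k)) (fun i => neg_le_neg (hD k i)) ⟨D k, rfl⟩
    simp only [mul_neg, Finset.sum_neg_distrib, zero_mul, sub_zero] at this
    linarith
  have hUanti : Antitone fun k => h k (U k) :=
    antitone_nat_of_succ_le fun k => hup k 1 _
  have hDmono : Monotone fun k => h k (D k) :=
    monotone_nat_of_le_succ fun k => hdown k 1 _
  have hDU : ∀ k, h k (D k) ≤ h k (U k) := fun k => hD k _
  have hUlim := tendsto_atTop_ciInf hUanti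
    ⟨h 0 (D 0), by rintro _ ⟨k, rfl⟩; exact (hDmono k.zero_le).trans (hDU k)⟩
  have hDlim := tendsto_atTop_ciSup hDmono
    ⟨h 0 (U 0), by rintro _ ⟨k, rfl⟩; exact (hDU k).trans (hUanti k.zero_le)⟩
  set u := ⨅ k, h k (U k)
  set d := ⨆ k, h k (D k)
  -- Every `p` steps the maximum drops by at least `δ` times the oscillation, so the limiting
  -- oscillation `u - d` vanishes.
  have hcontr : ∀ k, h (k + p) (U (k + p)) ≤ h k (U k) - δ * (h k (U k) - h k (D k)) :=
    fun k => by
      rw [hrec]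
      exact sum_mul_le_of_weights (hδ _) (hw _ _) (hw0 _ _) (hU k) ⟨D k, rfl⟩
  have hle : u ≤ u - δ * (u - d) :=
    le_of_tendsto_of_tendsto' ((tendsto_add_atTop_iff_nat p).mpr hUlim)
      (hUlim.sub ((hUlim.sub hDlim).const_mul δ)) hcontr
  have hdu : d ≤ u := le_of_tendsto_of_tendsto' hDlim hUlim hDU
  have hud : u = d := le_antisymm (by nlinarith) hdu
  refine ⟨d, fun b => ?_⟩
  exact tendsto_of_tendsto_of_tendsto_of_le_of_le hDlim (hud ▸ hUlim) (fun k => hD k b)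
    (fun k => hU k b)

variable [DecidableEq B]

theorem vecMul_pow_of_left_eigenvector {M : Matrix B B ℝ} {α : ℝ} {l : B → ℝ}
    (hl : l ᵥ* M = α • l) (n : ℕ) : l ᵥ* M ^ n = α ^ n • l := by
  induction n with
  | zero => simp
  | succ n ih =>
    rw [pow_succ, ← Matrix.vecMul_vecMul, ih, Matrix.smul_vecMul, hl, smul_smul, ← pow_succ]

/-- The column sums of the powers of a primitive matrix are asymptotically proportional to its
left eigenvector. -/
theorem Matrix.IsPrimitive.tendsto_column_sum [Nonempty B] {M : Matrix B B ℝ}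
    (hM : M.IsPrimitive) {α : ℝ} (hα : 0 < α) {l : B → ℝ} (hl0 : ∀ i, 0 < l i)
    (hl : l ᵥ* M = α • l) :
    ∃ c : ℝ, ∀ b, Tendsto (fun k : ℕ => (∑ i, (M ^ k) i b) / (α ^ k * l b)) atTop (𝓝 c) := by
  obtain ⟨p, -, hp⟩ := hM.exists_pos_pow
  have hnn : ∀ (k : ℕ) i j, 0 ≤ (M ^ k) i j := fun k => by
    induction k with
    | zero => intro i j; by_cases h : i = j <;> simp [h]
    | succ k ih =>
      intro i j
      rw [pow_succ]
      exact Finset.sum_nonneg fun x _ => mul_nonneg (ih _ _) (hM.nonneg _ _)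
  have hsum : ∀ (q : ℕ) b, ∑ i, l i * (M ^ q) i b = α ^ q * l b := fun q b => by
    simpa [Matrix.vecMul, dotProduct] using congrFun (vecMul_pow_of_left_eigenvector hl q) b
  have hden : ∀ (q : ℕ) b, 0 < α ^ q * l b := fun q b => mul_pos (pow_pos hα q) (hl0 b)
  obtain ⟨b₀, hb₀⟩ := Finite.exists_min fun x : B × B =>
    l x.2 * (M ^ p) x.2 x.1 / (α ^ p * l x.1)
  -- Since `l ᵥ* M ^ q = α ^ q • l`, rescaling by `l` turns the columns of `M ^ q` into probability
  -- vectors, and M^(k+q) = M^k M^q becomes the averaging recursion.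
  exact exists_tendsto_of_weights (p := p)
    (h := fun k b => (∑ i, (M ^ k) i b) / (α ^ k * l b))
    (w := fun q b i => l i * (M ^ q) i b / (α ^ q * l b))
    (div_pos (mul_pos (hl0 _) (hp _ _)) (hden p b₀.1))
    (fun q b => by rw [← Finset.sum_div, hsum, div_self (hden q b).ne'])
    (fun q b i => div_nonneg (mul_nonneg (hl0 i).le (hnn _ _ _)) (hden q b).le)
    (fun b i => hb₀ (b, i))
    (fun k q b => by
      have h1 : ∑ i, (M ^ (k + q)) i b = ∑ i, (∑ j, (M ^ k) j i) * (M ^ q) i b := by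
        simp only [pow_add, Matrix.mul_apply, Finset.sum_mul]
        exact Finset.sum_comm
      rw [h1, Finset.sum_div]
      refine Finset.sum_congr rfl fun i _ => ?_
      have := (hl0 i).ne'
      have := (hl0 b).ne'
      field_simp
      ring)

end Averages

/-! ### Block maps and their iterates -/

/-- `P` cuts the sequence `Y` into consecutive non-empty blocks `Y [P i, P (i + 1))` which are
determined by the letters `Y i`. -/
structure IsBlockMap {B : Type*} (Y : ℕ → B) (P : ℕ → ℕ) : Prop where
  zero : P 0 = 0
  strictMono : StrictMono P
  congr : ∀ i i', Y i = Y i' → ∀ j, P i + j < P (i + 1) →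
    P i' + j < P (i' + 1) ∧ Y (P i + j) = Y (P i' + j)

/-- A strictly increasing sequence starting at `0` cuts `ℕ` into intervals. -/
theorem StrictMono.exists_le_lt_succ {P : ℕ → ℕ} (hP : StrictMono P) (h0 : P 0 = 0) (N : ℕ) :
    ∃ i, P i ≤ N ∧ N < P (i + 1) := by
  have hex : ∃ i, N < P (i + 1) := ⟨N, N.lt_succ_self.trans_le (hP.id_le _)⟩
  classical
  refine ⟨Nat.find hex, ?_, Nat.find_spec hex⟩
  rcases Nat.eq_zero_or_pos (Nat.find hex) with h | h
  · rw [h, h0]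
    exact N.zero_le
  · have := Nat.find_min hex (m := Nat.find hex - 1) (by omega)
    rw [Nat.sub_add_cancel (Nat.succ_le_of_lt h)] at this
    exact not_lt.mp this

namespace IsBlockMap

variable {B : Type*} {Y : ℕ → B} {P Q : ℕ → ℕ}

theorem lt_succ (hP : IsBlockMap Y P) (i : ℕ) : P i < P (i + 1) :=
  hP.strictMono (Nat.lt_add_one i)

/-- Applying `congr` both ways shows that neither block is shorter. The additive form avoids
truncated subtraction. -/
theorem add_eq_add (hP : IsBlockMap Y P) {i i' : ℕ} (h : Y i = Y i') :
    P (i + 1) + P i' = P (i' + 1) + P i := by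
  have h1 := hP.lt_succ i
  have h2 := hP.lt_succ i'
  rcases lt_trichotomy (P (i + 1) + P i') (P (i' + 1) + P i) with hlt | heq | hgt
  · have := (hP.congr i' i h.symm (P (i + 1) - P i) (by omega)).1
    omega
  · exact heq
  · have := (hP.congr i i' h (P (i' + 1) - P i') (by omega)).1
    omega

/-- The images of equal words have equal lengths. -/
theorem add_eq_add_of_word (hP : IsBlockMap Y P) {a a' : ℕ} (s : ℕ)
    (h : ∀ j < s, Y (a + j) = Y (a' + j)) : P (a + s) + P a' = P (a' + s) + P a := by
  induction s with
  | zero => simp [add_comm]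
  | succ s ih =>
    have h1 := ih fun j hj => h j (hj.trans s.lt_succ_self)
    have h2 := hP.add_eq_add (h s s.lt_succ_self)
    simp only [← add_assoc] at h2 ⊢
    omega

/-- The images of equal words are equal. -/
theorem congr_of_word (hP : IsBlockMap Y P) {a a' : ℕ} (s : ℕ)
    (h : ∀ j < s, Y (a + j) = Y (a' + j)) {t : ℕ} (ht : P a + t < P (a + s)) :
    P a' + t < P (a' + s) ∧ Y (P a + t) = Y (P a' + t) := by
  have hlen := hP.add_eq_add_of_word s h
  refine ⟨by omega, ?_⟩
  obtain ⟨i, hi1, hi2⟩ := hP.strictMono.exists_le_lt_succ hP.zero (P a + t)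
  have hai : a ≤ i := by
    by_contra! hcon
    have := hP.strictMono.monotone (Nat.succ_le_of_lt hcon)
    simp only [Nat.succ_eq_add_one] at this
    omega
  have hia : i < a + s := hP.strictMono.lt_iff_lt.mp (hi1.trans_lt ht)
  obtain ⟨j, rfl⟩ := Nat.exists_eq_add_of_le hai
  have h1 := hP.add_eq_add_of_word j fun j' hj' => h j' (by omega)
  have h2 := (hP.congr (a + j) (a' + j) (h j (by omega)) (P a + t - P (a + j)) (by omega)).2
  rwa [show P (a + j) + (P a + t - P (a + j)) = P a + t by omega,
    show P (a' + j) + (P a + t - P (a + j)) = P a' + t by omega] at h2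

/-- A letter determines its `P`-block as a word, and a word determines its `Q`-image. -/
theorem comp (hQ : IsBlockMap Y Q) (hP : IsBlockMap Y P) : IsBlockMap Y (Q ∘ P) where
  zero := by simp [hP.zero, hQ.zero]
  strictMono := hQ.strictMono.comp hP.strictMono
  congr i i' h j hj := by
    have h1 := hP.add_eq_add h
    have h2 := hP.lt_succ i
    have h3 : P (i + 1) = P i + (P (i + 1) - P i) := by omega
    have h4 : P (i' + 1) = P i' + (P (i + 1) - P i) := by omega
    simp only [Function.comp_apply] at hj ⊢
    rw [h3] at hj
    rw [h4]
    exact hQ.congr_of_word _ (fun j' hj' => (hP.congr i i' h j' (by omega)).2) hj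

theorem iterate (hP : IsBlockMap Y P) (k : ℕ) : IsBlockMap Y P^[k] := by
  induction k with
  | zero =>
    refine ⟨rfl, strictMono_id, fun i i' h j hj => ?_⟩
    simp only [Function.iterate_zero, id_eq] at hj ⊢
    obtain rfl : j = 0 := by omega
    simpa using h
  | succ k ih =>
    rw [Function.iterate_succ]
    exact ih.comp hP

end IsBlockMap

/-! ### Fixed points as block maps, and counting by the matrix -/

namespace Substitution

variable {B : Type*}

theorem seqPrefix_succ (Y : ℕ → B) (n : ℕ) : seqPrefix Y (n + 1) = seqPrefix Y n ++ [Y n] := by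
  simp [seqPrefix, List.range_succ]

theorem onWord_seqPrefix_succ (τ : Substitution B) (Y : ℕ → B) (n : ℕ) :
    τ.onWord (seqPrefix Y (n + 1)) = τ.onWord (seqPrefix Y n) ++ τ.toFun (Y n) := by
  simp [seqPrefix_succ, onWord]

/-- The position in `τ(Y)` of the image of the letter `Y i`. -/
def position (τ : Substitution B) (Y : ℕ → B) (i : ℕ) : ℕ :=
  (τ.onWord (seqPrefix Y i)).length

theorem position_succ (τ : Substitution B) (Y : ℕ → B) (i : ℕ) :
    τ.position Y (i + 1) = τ.position Y i + (τ.toFun (Y i)).length := by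
  simp [position, onWord_seqPrefix_succ]

theorem strictMono_position (τ : Substitution B) (Y : ℕ → B) : StrictMono (τ.position Y) :=
  strictMono_nat_of_lt_succ fun i => by
    rw [position_succ]
    exact Nat.lt_add_of_pos_right (List.length_pos_iff.mpr (τ.ne_nil _))

theorem onWord_seqPrefix_prefix (τ : Substitution B) (Y : ℕ → B) {m n : ℕ} (h : m ≤ n) :
    τ.onWord (seqPrefix Y m) <+: τ.onWord (seqPrefix Y n) := by
  induction n, h using Nat.le_induction with
  | base => exact List.prefix_refl _
  | succ n _ ih =>
    rw [onWord_seqPrefix_succ]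
    exact ih.trans (List.prefix_append _ _)

theorem getElem?_onWord_seqPrefix (τ : Substitution B) (Y : ℕ → B) {m n : ℕ}
    (h : n < τ.position Y m) : (τ.onWord (seqPrefix Y m))[n]? = some (τ.onSeq Y n) := by
  have hn : n < τ.position Y (n + 1) :=
    n.lt_succ_self.trans_le ((τ.strictMono_position Y).id_le _)
  have h1 : (τ.onWord (seqPrefix Y (n + 1)))[n]? = some (τ.onSeq Y n) :=
    List.getElem?_eq_getElem hn
  rcases le_total m (n + 1) with hle | hle
  · obtain ⟨t, ht⟩ := τ.onWord_seqPrefix_prefix Y hle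
    rw [← h1, ← ht, List.getElem?_append_left h]
  · obtain ⟨t, ht⟩ := τ.onWord_seqPrefix_prefix Y hle
    rw [← h1, ← ht, List.getElem?_append_left hn]

theorem onWord_seqPrefix (τ : Substitution B) (Y : ℕ → B) (m : ℕ) :
    τ.onWord (seqPrefix Y m) = seqPrefix (τ.onSeq Y) (τ.position Y m) := by
  refine List.ext_getElem? fun n => ?_
  rcases lt_or_ge n (τ.position Y m) with h | h
  · rw [getElem?_onWord_seqPrefix τ Y h]
    simp [seqPrefix, h]
  · rw [List.getElem?_eq_none h, List.getElem?_eq_none (by simpa [seqPrefix] using h)]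

theorem IsFixedPoint.getElem?_toFun {τ : Substitution B} {Y : ℕ → B} (hY : τ.IsFixedPoint Y)
    (i j : ℕ) (hj : j < (τ.toFun (Y i)).length) :
    (τ.toFun (Y i))[j]? = some (Y (τ.position Y i + j)) := by
  have h := τ.getElem?_onWord_seqPrefix Y (m := i + 1) (n := τ.position Y i + j)
    (by rw [position_succ]; omega)
  rw [hY.2, onWord_seqPrefix_succ, List.getElem?_append_right (by simp [position])] at h
  simpa [position] using h

theorem IsFixedPoint.isBlockMap {τ : Substitution B} {Y : ℕ → B} (hY : τ.IsFixedPoint Y) :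
    IsBlockMap Y (τ.position Y) where
  zero := rfl
  strictMono := τ.strictMono_position Y
  congr i i' h j hj := by
    rw [position_succ] at hj ⊢
    have hj' : j < (τ.toFun (Y i)).length := by omega
    refine ⟨by rw [← h]; omega, ?_⟩
    have h1 := hY.getElem?_toFun i j hj'
    have h2 := hY.getElem?_toFun i' j (h ▸ hj')
    rw [← h, h1] at h2
    exact Option.some_injective _ h2

variable [Fintype B] [DecidableEq B]

theorem sum_map_toFun (τ : Substitution B) (f : B → ℝ) (b : B) :
    ((τ.toFun b).map f).sum = (f ᵥ* τ.matrix) b := by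
  rw [Finset.sum_list_map_count, Matrix.vecMul, dotProduct,
    Finset.sum_subset (Finset.subset_univ _)]
  · exact Finset.sum_congr rfl fun i _ => by simp [matrix, mul_comm]
  · intro i _ hi
    rw [List.count_eq_zero_of_not_mem (by simpa using hi), zero_smul]

/-- The weight of a prefix of the image of `Y` is computed by the matrix. -/
theorem IsFixedPoint.sum_position {τ : Substitution B} {Y : ℕ → B} (hY : τ.IsFixedPoint Y)
    (f : B → ℝ) (N : ℕ) :
    ∑ n ∈ Finset.range (τ.position Y N), f (Y n) =
      ∑ j ∈ Finset.range N, (f ᵥ* τ.matrix) (Y j) := by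
  have h : ∀ m, ((seqPrefix Y m).map f).sum = ∑ n ∈ Finset.range m, f (Y n) := fun m => by
    induction m with
    | zero => simp [seqPrefix]
    | succ m ih => simp [seqPrefix_succ, ih, Finset.sum_range_succ]
  have h1 := τ.onWord_seqPrefix Y N
  rw [hY.2] at h1
  rw [← h, ← h1]
  induction N with
  | zero => simp [seqPrefix, onWord]
  | succ N ih =>
    rw [onWord_seqPrefix_succ, List.map_append, List.sum_append, Finset.sum_range_succ,
      sum_map_toFun, ih (by rw [onWord_seqPrefix, hY.2])]

theorem IsFixedPoint.sum_position_iterate {τ : Substitution B} {Y : ℕ → B}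
    (hY : τ.IsFixedPoint Y) (f : B → ℝ) (k N : ℕ) :
    ∑ n ∈ Finset.range ((τ.position Y)^[k] N), f (Y n) =
      ∑ j ∈ Finset.range N, (f ᵥ* τ.matrix ^ k) (Y j) := by
  induction k generalizing f with
  | zero => simp
  | succ k ih =>
    rw [Function.iterate_succ', Function.comp_apply, hY.sum_position, ih, Matrix.vecMul_vecMul,
      ← pow_succ']

end Substitution

/-! ### Upper slopes and their scaling -/

/-- `e N = o(N)`. -/
def IsSublinear (e : ℕ → ℝ) : Prop :=
  ∀ ε > 0, ∃ C, ∀ N : ℕ, |e N| ≤ ε * N + C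

/-- The slopes of the affine functions which bound `f` from above. -/
def slopeBounds (f : ℕ → ℝ) : Set ℝ :=
  {s | ∃ C, ∀ N : ℕ, f N ≤ s * N + C}

/-- The least asymptotic slope of an affine upper bound of `f`, which is the upper limit of
`f N / N`. -/
noncomputable def upperSlope (f : ℕ → ℝ) : ℝ :=
  sInf (slopeBounds f)

theorem le_of_mul_le_mul_add {δ s C : ℝ} (h : ∀ N : ℕ, δ * N ≤ s * N + C) : δ ≤ s := by
  by_contra! hlt
  obtain ⟨N, hN⟩ := exists_nat_gt (C / (δ - s))
  rw [div_lt_iff₀ (sub_pos.mpr hlt)] at hN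
  linarith [h N]

theorem le_of_mem_slopeBounds {f : ℕ → ℝ} {δ s : ℝ} (hf : ∀ N : ℕ, δ * N ≤ f N)
    (hs : s ∈ slopeBounds f) : δ ≤ s := by
  obtain ⟨C, hC⟩ := hs
  exact le_of_mul_le_mul_add fun N => (hf N).trans (hC N)

theorem bddBelow_slopeBounds {f : ℕ → ℝ} (hf : ∀ N, 0 ≤ f N) : BddBelow (slopeBounds f) :=
  ⟨0, fun _ hs => le_of_mem_slopeBounds (fun N => by simpa using hf N) hs⟩

theorem le_upperSlope {f : ℕ → ℝ} {δ : ℝ} (hne : (slopeBounds f).Nonempty)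
    (hf : ∀ N : ℕ, δ * N ≤ f N) : δ ≤ upperSlope f :=
  le_csInf hne fun _ hs => le_of_mem_slopeBounds hf hs

theorem upperSlope_mono {f g : ℕ → ℝ} (hne : (slopeBounds g).Nonempty) (hf : ∀ N, 0 ≤ f N)
    (h : ∀ N, f N ≤ g N) : upperSlope f ≤ upperSlope g :=
  csInf_le_csInf (bddBelow_slopeBounds hf) hne fun _ ⟨C, hC⟩ => ⟨C, fun N => (h N).trans (hC N)⟩

/-- Insert p(N) ≤ (a + ε)N + C₁ into the affine bound of `f`. The choice ε = η/(s+1) gives sε ≤ η,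
including when s = 0. -/
theorem mul_add_mem_slopeBounds_comp {f : ℕ → ℝ} (hf : ∀ N, 0 ≤ f N) {p : ℕ → ℕ} {a : ℝ}
    (hp : IsSublinear fun N => p N - a * N) {s η : ℝ} (hs : s ∈ slopeBounds f) (hη : 0 < η) :
    a * s + η ∈ slopeBounds (fun N => f (p N)) := by
  have hs0 : 0 ≤ s := le_of_mem_slopeBounds (fun N => by simpa using hf N) hs
  obtain ⟨C, hC⟩ := hs
  obtain ⟨C₁, hC₁⟩ := hp (η / (s + 1)) (by positivity)
  refine ⟨s * C₁ + C, fun N => ?_⟩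
  have h1 := (abs_le.mp (hC₁ N)).2
  have h2 : s * (p N : ℝ) ≤ s * (a * N + (η / (s + 1) * N + C₁)) :=
    mul_le_mul_of_nonneg_left (by linarith) hs0
  have h3 : s * (η / (s + 1)) ≤ η := by
    rw [mul_div_assoc', div_le_iff₀ (by positivity)]
    nlinarith
  have h4 := mul_le_mul_of_nonneg_right h3 (Nat.cast_nonneg (α := ℝ) N)
  linarith [hC (p N)]

/-- By monotonicity `f N` is at most `f` at the next sample p(i+1), where p(i) ≤ N; and p(i) ≈ ai
bounds i by about N/a. -/
theorem div_add_mem_slopeBounds {f : ℕ → ℝ} (hf : ∀ N, 0 ≤ f N) (hmono : Monotone f)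
    {p : ℕ → ℕ} (hpm : StrictMono p) (hp0 : p 0 = 0) {a : ℝ} (ha : 0 < a)
    (hp : IsSublinear fun N => p N - a * N) {s η : ℝ}
    (hs : s ∈ slopeBounds (fun N => f (p N))) (hη : 0 < η) :
    s / a + η ∈ slopeBounds f := by
  have hs0 : 0 ≤ s := le_of_mem_slopeBounds (fun N => by simpa using hf (p N)) hs
  obtain ⟨C, hC⟩ := hs
  obtain ⟨C₁, hC₁⟩ := hp (η * a / (s + 1)) (by positivity)
  refine ⟨s / a * C₁ + s + C, fun N => ?_⟩
  obtain ⟨i, hi1, hi2⟩ := hpm.exists_le_lt_succ hp0 N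
  have h1 := (abs_le.mp (hC₁ i)).1
  have hiN : (i : ℝ) ≤ N := by exact_mod_cast (hpm.id_le i).trans hi1
  have hpN : (p i : ℝ) ≤ N := by exact_mod_cast hi1
  have h2 : f N ≤ s * (i + 1) + C := by
    have := (hmono hi2.le).trans (hC (i + 1))
    push_cast at this
    exact this
  have hε : 0 ≤ η * a / (s + 1) := by positivity
  have h3 : a * i ≤ N + η * a / (s + 1) * N + C₁ := by nlinarith
  have h4 : s * i ≤ s / a * (N + η * a / (s + 1) * N + C₁) := by
    calc s * i = s / a * (a * i) := by field_simp
      _ ≤ _ := mul_le_mul_of_nonneg_left h3 (by positivity)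
  have h5 : s / a * (η * a / (s + 1)) ≤ η := by
    have : s / a * (η * a / (s + 1)) = s * η / (s + 1) := by field_simp
    rw [this, div_le_iff₀ (by positivity)]
    nlinarith
  have h6 := mul_le_mul_of_nonneg_right h5 (Nat.cast_nonneg (α := ℝ) N)
  linarith

/-- Sampling a monotone function along a sequence of slope `a` multiplies its slope by `a`. -/
theorem upperSlope_comp {f : ℕ → ℝ} (hf : ∀ N, 0 ≤ f N) (hmono : Monotone f)
    (hne : (slopeBounds f).Nonempty) {p : ℕ → ℕ} (hpm : StrictMono p) (hp0 : p 0 = 0) {a : ℝ}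
    (ha : 0 < a) (hp : IsSublinear fun N => p N - a * N) :
    upperSlope (fun N => f (p N)) = a * upperSlope f := by
  refine le_antisymm ?_ ?_
  · rw [← div_le_iff₀' ha]
    refine le_csInf hne fun s hs => ?_
    rw [div_le_iff₀' ha]
    exact le_of_forall_pos_le_add fun η hη => csInf_le (bddBelow_slopeBounds fun N => hf (p N))
      (mul_add_mem_slopeBounds_comp hf hp hs hη)
  · obtain ⟨s₀, hs₀⟩ := hne
    refine le_csInf ⟨_, mul_add_mem_slopeBounds_comp hf hp hs₀ one_pos⟩ fun s hs => ?_
    rw [← le_div_iff₀' ha]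
    exact le_of_forall_pos_le_add fun η hη => csInf_le (bddBelow_slopeBounds hf)
      (div_add_mem_slopeBounds hf hmono hpm hp0 ha hp hs hη)

/-! ### Self-similarity of primitive fixed points -/

/-- The iterates of the block map `P` of the sequence `Y` have blocks of length comparable to
`α ^ k` and of average length `α ^ k`, and the first letter of `Y` has positive density. -/
structure IsSelfSimilar {B : Type*} (Y : ℕ → B) (P : ℕ → ℕ) (α c C : ℝ) : Prop where
  isBlockMap : IsBlockMap Y P
  one_lt : 1 < α
  pos : 0 < c
  lower : ∀ k i : ℕ, P^[k] i + c * α ^ k ≤ P^[k] (i + 1)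
  upper : ∀ k i : ℕ, (P^[k] (i + 1) : ℝ) ≤ P^[k] i + C * α ^ k
  sublinear : ∀ k : ℕ, IsSublinear fun N => P^[k] N - α ^ k * N
  recurrent : 0 < upperSlope fun N => ∑ i ∈ Finset.range N, ({Y 0} : Set B).indicator 1 (Y i)

section

variable {B : Type*} [Fintype B] [DecidableEq B]

theorem Substitution.exists_pow_matrix_eq_natCast (τ : Substitution B) (k : ℕ) (i j : B) :
    ∃ m : ℕ, (τ.matrix ^ k) i j = m := by
  have h : τ.matrix = (Matrix.of fun i j => (τ.toFun j).count i).map (Nat.castRingHom ℝ) := by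
    ext i j
    simp [Substitution.matrix]
  rw [h, ← Matrix.map_pow]
  exact ⟨_, rfl⟩

/-- The dominant eigenvalue is greater than `1` unless the alphabet has one letter. -/
theorem Substitution.one_lt_of_left_eigenvector [Nontrivial B] {τ : Substitution B}
    (hτ : τ.IsPrimitive) {α : ℝ} (hα : 0 < α) {l : B → ℝ} (hl0 : ∀ i, 0 < l i)
    (hl : l ᵥ* τ.matrix = α • l) : 1 < α := by
  obtain ⟨p, -, hp⟩ := hτ.exists_pos_pow
  by_contra! hle
  obtain ⟨b, b', hbb⟩ := exists_pair_ne B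
  have h1 : ∑ i, l i * (τ.matrix ^ p) i b = α ^ p * l b := by
    simpa [Matrix.vecMul, dotProduct] using congrFun (vecMul_pow_of_left_eigenvector hl p) b
  -- Positive entries of an integer matrix are at least 1; with `α ≤ 1` this gives l(b) + l(b') ≤
  -- α^p l(b) ≤ l(b).
  have h2 : ∑ i, l i ≤ ∑ i, l i * (τ.matrix ^ p) i b := by
    refine Finset.sum_le_sum fun i _ => le_mul_of_one_le_right (hl0 i).le ?_
    obtain ⟨m, hm⟩ := τ.exists_pow_matrix_eq_natCast p i b
    have := hp i b
    rw [hm] at this ⊢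
    exact_mod_cast this
  have h3 : l b + l b' ≤ ∑ i, l i := by
    rw [← Finset.sum_pair hbb]
    exact Finset.sum_le_sum_of_subset_of_nonneg (Finset.subset_univ _) fun i _ _ => (hl0 i).le
  have h4 : α ^ p * l b ≤ 1 * l b :=
    mul_le_mul_of_nonneg_right (pow_le_one₀ hα.le hle) (hl0 b).le
  linarith [hl0 b']

end

section

variable {B : Type*} [Fintype B]

theorem sum_indicator_singleton_vecMul (M : Matrix B B ℝ) (a b : B) :
    ((({a} : Set B).indicator 1 : B → ℝ) ᵥ* M) b = M a b := by
  rw [Matrix.vecMul, dotProduct, Finset.sum_eq_single a]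
  · simp
  · intro i _ hi
    simp [hi]
  · simp

variable [DecidableEq B]

theorem Substitution.matrix_pow_nonneg (τ : Substitution B) (k : ℕ) (i j : B) :
    0 ≤ (τ.matrix ^ k) i j := by
  obtain ⟨m, hm⟩ := τ.exists_pow_matrix_eq_natCast k i j
  exact hm ▸ m.cast_nonneg

theorem Substitution.one_le_matrix_pow {τ : Substitution B} {k : ℕ} {i j : B}
    (h : 0 < (τ.matrix ^ k) i j) : 1 ≤ (τ.matrix ^ k) i j := by
  obtain ⟨m, hm⟩ := τ.exists_pow_matrix_eq_natCast k i j
  rw [hm] at h ⊢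
  exact_mod_cast h

/-- A weight whose values on the letters become relatively small under iteration has sublinear
partial sums. -/
theorem Substitution.IsFixedPoint.isSublinear_sum {τ : Substitution B} {Y : ℕ → B}
    (hY : τ.IsFixedPoint Y) {f : B → ℝ} {α C : ℝ} (hC : ∀ k i : ℕ,
      ((τ.position Y)^[k] (i + 1) : ℝ) ≤ (τ.position Y)^[k] i + C * α ^ k)
    {l : B → ℝ} {lmax : ℝ} (hlmax0 : 0 < lmax) (hlmax : ∀ b, l b ≤ lmax)
    (hl : l ᵥ* τ.matrix = α • l)
    (hf : ∀ ε > 0, ∃ k, ∀ b, |(f ᵥ* τ.matrix ^ k) b| ≤ ε * (α ^ k * l b)) :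
    IsSublinear fun N => ∑ n ∈ Finset.range N, f (Y n) := by
  intro ε hε
  -- The complete blocks of level `k` contribute at most `ε` times their total length, and the
  -- incomplete last block only a constant.
  obtain ⟨k, hk⟩ := hf (ε / lmax) (by positivity)
  obtain ⟨b₁, hb₁⟩ := have : Nonempty B := ⟨Y 0⟩; Finite.exists_max fun b => |f b|
  refine ⟨|f b₁| * (C * α ^ k), fun N => ?_⟩
  have hb := hY.isBlockMap.iterate k
  set Q := (τ.position Y)^[k] with hQ
  obtain ⟨i, hi1, hi2⟩ := hb.strictMono.exists_le_lt_succ hb.zero N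
  have h1 : |∑ n ∈ Finset.range (Q i), f (Y n)| ≤ ε * N := by
    rw [hQ, hY.sum_position_iterate]
    calc |∑ j ∈ Finset.range i, (f ᵥ* τ.matrix ^ k) (Y j)|
        ≤ ∑ j ∈ Finset.range i, |(f ᵥ* τ.matrix ^ k) (Y j)| := Finset.abs_sum_le_sum_abs _ _
      _ ≤ ∑ j ∈ Finset.range i, ε / lmax * (l ᵥ* τ.matrix ^ k) (Y j) :=
          Finset.sum_le_sum fun j _ => by
            rw [vecMul_pow_of_left_eigenvector hl]
            exact hk _
      _ = ε / lmax * ∑ n ∈ Finset.range (Q i), l (Y n) := by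
          rw [← Finset.mul_sum, hQ, hY.sum_position_iterate]
      _ ≤ ε / lmax * (Q i * lmax) := by
          refine mul_le_mul_of_nonneg_left ?_ (by positivity)
          simpa using Finset.sum_le_sum fun n (_ : n ∈ Finset.range (Q i)) => hlmax (Y n)
      _ = ε * Q i := by field_simp
      _ ≤ ε * N := by gcongr
  have h2 : |∑ n ∈ Finset.Ico (Q i) N, f (Y n)| ≤ |f b₁| * (C * α ^ k) := by
    calc |∑ n ∈ Finset.Ico (Q i) N, f (Y n)|
        ≤ ∑ n ∈ Finset.Ico (Q i) N, |f (Y n)| := Finset.abs_sum_le_sum_abs _ _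
      _ ≤ ∑ n ∈ Finset.Ico (Q i) N, |f b₁| := Finset.sum_le_sum fun n _ => hb₁ _
      _ = |f b₁| * (N - Q i) := by
          rw [Finset.sum_const, Nat.card_Ico, nsmul_eq_mul, Nat.cast_sub hi1, mul_comm]
      _ ≤ |f b₁| * (C * α ^ k) := by
          refine mul_le_mul_of_nonneg_left ?_ (abs_nonneg _)
          have : (N : ℝ) ≤ Q (i + 1) := by exact_mod_cast hi2.le
          linarith [hC k i]
  simp only
  rw [← Finset.sum_range_add_sum_Ico _ hi1]
  exact (abs_add_le _ _).trans (add_le_add h1 h2)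

/-- The fixed point of a primitive substitution is self-similar with ratio the dominant
eigenvalue. -/
theorem Substitution.IsFixedPoint.isSelfSimilar [Nontrivial B] {τ : Substitution B}
    (hτ : τ.IsPrimitive) {Y : ℕ → B} (hY : τ.IsFixedPoint Y) {α : ℝ}
    (hα : IsDominantEigenvalue τ.matrix α) :
    ∃ c C, IsSelfSimilar Y (τ.position Y) α c C := by
  obtain ⟨hα0, l, hl0, hl⟩ := hα.exists_pos_left_eigenvector hτ
  obtain ⟨a, ha⟩ := Matrix.IsPrimitive.tendsto_column_sum hτ hα0 hl0 hl
  obtain ⟨b₀, hb₀⟩ := Finite.exists_min l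
  obtain ⟨b₁, hb₁⟩ := Finite.exists_max l
  have hsum : ∀ (k : ℕ) b, ∑ i, l i * (τ.matrix ^ k) i b = α ^ k * l b := fun k b => by
    simpa [Matrix.vecMul, dotProduct] using congrFun (vecMul_pow_of_left_eigenvector hl k) b
  have hone : ∀ (k : ℕ) b, ((1 : B → ℝ) ᵥ* τ.matrix ^ k) b = ∑ i, (τ.matrix ^ k) i b :=
    fun k b => by simp [Matrix.vecMul, dotProduct]
  have hpos : ∀ k N : ℕ, ((τ.position Y)^[k] N : ℝ) =
      ∑ j ∈ Finset.range N, ∑ i, (τ.matrix ^ k) i (Y j) := fun k N => by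
    simpa [hone] using hY.sum_position_iterate 1 k N
  have hlow : ∀ (k : ℕ) b, l b₀ / l b₁ * α ^ k ≤ ∑ i, (τ.matrix ^ k) i b := fun k b => by
    rw [div_mul_eq_mul_div, div_le_iff₀ (hl0 b₁), Finset.sum_mul]
    calc l b₀ * α ^ k ≤ α ^ k * l b := by
          rw [mul_comm]
          exact mul_le_mul_of_nonneg_left (hb₀ b) (pow_pos hα0 k).le
      _ ≤ _ := by
          rw [← hsum]
          exact Finset.sum_le_sum fun i _ => by
            rw [mul_comm]
            exact mul_le_mul_of_nonneg_left (hb₁ i) (τ.matrix_pow_nonneg k i b)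
  have hupp : ∀ (k : ℕ) b, ∑ i, (τ.matrix ^ k) i b ≤ l b₁ / l b₀ * α ^ k := fun k b => by
    rw [div_mul_eq_mul_div, le_div_iff₀ (hl0 b₀), Finset.sum_mul]
    calc _ ≤ α ^ k * l b := by
          rw [← hsum]
          exact Finset.sum_le_sum fun i _ => by
            rw [mul_comm]
            exact mul_le_mul_of_nonneg_right (hb₀ i) (τ.matrix_pow_nonneg k i b)
      _ ≤ l b₁ * α ^ k := by
          rw [mul_comm]
          exact mul_le_mul_of_nonneg_right (hb₁ b) (pow_pos hα0 k).le
  have hupper : ∀ k i : ℕ, ((τ.position Y)^[k] (i + 1) : ℝ) ≤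
      (τ.position Y)^[k] i + l b₁ / l b₀ * α ^ k := fun k i => by
    rw [hpos, hpos, Finset.sum_range_succ]
    linarith [hupp k (Y i)]
  -- The weight `1 - a • l` becomes relatively small under iteration because the column sums are
  -- asymptotic to a α^k l. Thus N = aΛ(N) + o(N), where Λ is the partial sum of `l` along `Y`.
  have hD : IsSublinear fun N => ∑ n ∈ Finset.range N, ((1 : B → ℝ) - a • l) (Y n) := by
    refine hY.isSublinear_sum hupper (hl0 b₁) hb₁ hl fun ε hε => ?_
    have hev : ∀ᶠ k : ℕ in atTop, ∀ b,
        |(∑ i, (τ.matrix ^ k) i b) / (α ^ k * l b) - a| < ε := by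
      rw [eventually_all]
      exact fun b => (Metric.tendsto_nhds.mp (ha b)) ε hε
    obtain ⟨k, hk⟩ := hev.exists
    refine ⟨k, fun b => ?_⟩
    have hden : 0 < α ^ k * l b := mul_pos (pow_pos hα0 k) (hl0 b)
    have h1 : (((1 : B → ℝ) - a • l) ᵥ* τ.matrix ^ k) b =
        ((∑ i, (τ.matrix ^ k) i b) / (α ^ k * l b) - a) * (α ^ k * l b) := by
      rw [Matrix.sub_vecMul, Matrix.smul_vecMul, vecMul_pow_of_left_eigenvector hl, sub_mul,
        div_mul_cancel₀ _ hden.ne', Pi.sub_apply, hone]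
      simp
    rw [h1, abs_mul, abs_of_pos hden]
    exact mul_le_mul_of_nonneg_right (hk b).le hden.le
  have hDN : (fun N => ∑ n ∈ Finset.range N, ((1 : B → ℝ) - a • l) (Y n)) =
      fun N : ℕ => N - a * ∑ n ∈ Finset.range N, l (Y n) := by
    ext N
    simp [Finset.mul_sum]
  rw [hDN] at hD
  -- Λ is multiplied exactly by α^k when passing from N to the position of the N-th block, so that
  -- position is aα^kΛ(N) + o(N) = α^k N + o(N).
  have hsub : ∀ k : ℕ, IsSublinear fun N => (τ.position Y)^[k] N - α ^ k * N := by
    intro k ε hε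
    have hαk := pow_pos hα0 k
    have hC0 : 0 < l b₁ / l b₀ * α ^ k := mul_pos (div_pos (hl0 _) (hl0 _)) hαk
    obtain ⟨C₁, hC₁⟩ := hD (ε / 2 / (l b₁ / l b₀ * α ^ k)) (by positivity)
    obtain ⟨C₂, hC₂⟩ := hD (ε / 2 / α ^ k) (by positivity)
    refine ⟨C₁ + α ^ k * C₂, fun N => ?_⟩
    have hΛ : ∑ n ∈ Finset.range ((τ.position Y)^[k] N), l (Y n) =
        α ^ k * ∑ n ∈ Finset.range N, l (Y n) := by
      rw [hY.sum_position_iterate, vecMul_pow_of_left_eigenvector hl, Finset.mul_sum]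
      rfl
    have h1 := hC₁ ((τ.position Y)^[k] N)
    have h2 := mul_le_mul_of_nonneg_left (hC₂ N) hαk.le
    have h3 : ((τ.position Y)^[k] N : ℝ) ≤ l b₁ / l b₀ * α ^ k * N := by
      rw [hpos]
      simpa [mul_comm] using
        Finset.sum_le_sum fun j (_ : j ∈ Finset.range N) => hupp k (Y j)
    have h4 : ε / 2 / (l b₁ / l b₀ * α ^ k) * (τ.position Y)^[k] N ≤ ε / 2 * N := by
      rw [div_mul_eq_mul_div, div_le_iff₀ hC0]
      nlinarith
    have h5 : α ^ k * (ε / 2 / α ^ k * N + C₂) = ε / 2 * N + α ^ k * C₂ := by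
      field_simp
    rw [h5] at h2
    simp only [hΛ] at h1
    have h6 : (((τ.position Y)^[k] N : ℕ) : ℝ) - α ^ k * N =
        ((τ.position Y)^[k] N - a * (α ^ k * ∑ n ∈ Finset.range N, l (Y n))) -
          α ^ k * (N - a * ∑ n ∈ Finset.range N, l (Y n)) := by ring
    simp only
    rw [h6]
    refine (abs_sub _ _).trans ?_
    rw [abs_mul, abs_of_pos hαk]
    linarith
  refine ⟨l b₀ / l b₁, l b₁ / l b₀, hY.isBlockMap,
    τ.one_lt_of_left_eigenvector hτ hα0 hl0 hl, div_pos (hl0 _) (hl0 _), fun k i => ?_, hupper,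
    hsub, ?_⟩
  · rw [hpos, hpos, Finset.sum_range_succ]
    linarith [hlow k (Y i)]
  -- Every block of level `p` contains the letter `Y 0`, so the count sampled at the block ends has
  -- slope at least 1.
  · obtain ⟨p, -, hp⟩ := hτ.exists_pos_pow
    have hb := hY.isBlockMap.iterate p
    set f : ℕ → ℝ := fun N => ∑ i ∈ Finset.range N, ({Y 0} : Set B).indicator 1 (Y i) with hf
    have hind0 : ∀ b, 0 ≤ ({Y 0} : Set B).indicator (1 : B → ℝ) b :=
      Set.indicator_nonneg fun _ _ => zero_le_one
    have hf0 : ∀ N, 0 ≤ f N := fun N => Finset.sum_nonneg fun i _ => hind0 _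
    have hmono : Monotone f := monotone_nat_of_le_succ fun N => by
      simp only [hf, Finset.sum_range_succ]
      exact le_add_of_nonneg_right (hind0 _)
    have h1 : (1 : ℝ) ∈ slopeBounds f := ⟨0, fun N => by
      simpa [hf] using Finset.sum_le_sum fun i (_ : i ∈ Finset.range N) =>
        Set.indicator_le_self' (s := {Y 0}) (f := (1 : B → ℝ)) (fun _ _ => zero_le_one) (Y i)⟩
    have h2 := upperSlope_comp hf0 hmono ⟨1, h1⟩ hb.strictMono hb.zero (pow_pos hα0 p) (hsub p)
    have h3 : 1 ≤ upperSlope fun N => f ((τ.position Y)^[p] N) := by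
      refine le_upperSlope ⟨_, mul_add_mem_slopeBounds_comp hf0 (hsub p) h1 one_pos⟩ fun N => ?_
      simp only [hf]
      rw [hY.sum_position_iterate]
      simpa [sum_indicator_singleton_vecMul] using
        Finset.sum_le_sum fun j (_ : j ∈ Finset.range N) => one_le_matrix_pow (hp (Y 0) (Y j))
    rw [h2] at h3
    exact pos_of_mul_pos_right (zero_lt_one.trans_le h3) (pow_pos hα0 p).le

end

/-! ### Occurrences of prefixes: recurrence, separation, finitely many densities -/

/-- The prefix of length `n` of `X` occurs at position `q`. -/
def PrefixOccurs {A : Type*} (X : ℕ → A) (n q : ℕ) : Prop :=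
  ∀ j < n, X (q + j) = X j

open Classical in
/-- The number of occurrences of the prefix of length `n` of `X` at positions less than `N`. -/
noncomputable def prefixCount {A : Type*} (X : ℕ → A) (n N : ℕ) : ℕ :=
  ((Finset.range N).filter (PrefixOccurs X n)).card

namespace IsSelfSimilar

variable {A B : Type*} {Y : ℕ → B} {P : ℕ → ℕ} {α c C : ℝ}

theorem one_le_upper (h : IsSelfSimilar Y P α c C) : 1 ≤ C := by
  simpa using h.upper 0 0

theorem pow_pos (h : IsSelfSimilar Y P α c C) (k : ℕ) : 0 < α ^ k :=
  _root_.pow_pos (zero_lt_one.trans h.one_lt) k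

/-- Every length is comparable to the lengths of the blocks of a suitable level. -/
theorem exists_scale (h : IsSelfSimilar Y P α c C) :
    ∃ D : ℕ, ∀ n : ℕ, ∃ k : ℕ, 0 < n → n ≤ c * α ^ k ∧ C * α ^ k ≤ D * n := by
  have hC := h.one_le_upper
  have hc := h.pos
  have hα := zero_lt_one.trans h.one_lt
  -- Take the least level `k` with n ≤ cα^k. The summand C serves k = 0; otherwise cα^(k-1) < n
  -- gives Cα^k ≤ (Cα/c)n.
  refine ⟨⌈C + C * α / c⌉₊, fun n => ?_⟩
  have hex : ∃ k : ℕ, (n : ℝ) ≤ c * α ^ k := by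
    obtain ⟨k, hk⟩ := pow_unbounded_of_one_lt (n / c) h.one_lt
    exact ⟨k, by rw [div_lt_iff₀ hc] at hk; linarith⟩
  classical
  refine ⟨Nat.find hex, fun hn => ⟨Nat.find_spec hex, ?_⟩⟩
  have hn1 : (1 : ℝ) ≤ n := by exact_mod_cast hn
  refine le_trans ?_ (mul_le_mul_of_nonneg_right (Nat.le_ceil _) n.cast_nonneg)
  have hq : 0 ≤ C * α / c := by positivity
  rcases hk : Nat.find hex with _ | k
  · rw [pow_zero]
    nlinarith
  · have h1 := not_le.mp (Nat.find_min hex (m := k) (by omega))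
    have h2 : C * α ^ (k + 1) = C * α / c * (c * α ^ k) := by
      field_simp
      ring
    rw [h2]
    have h3 := mul_le_mul_of_nonneg_left h1.le hq
    nlinarith

theorem add_le_of_le (h : IsSelfSimilar Y P α c C) {n k : ℕ} (hn : (n : ℝ) ≤ c * α ^ k) (i : ℕ) :
    P^[k] i + n ≤ P^[k] (i + 1) := by
  have := h.lower k i
  have h1 : ((P^[k] i + n : ℕ) : ℝ) ≤ P^[k] (i + 1) := by push_cast; linarith
  exact_mod_cast h1

theorem le_add_of_le (h : IsSelfSimilar Y P α c C) {n D k : ℕ} (hn : C * α ^ k ≤ D * n) (i : ℕ) :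
    P^[k] (i + 1) ≤ P^[k] i + D * n := by
  have := h.upper k i
  have h1 : ((P^[k] (i + 1) : ℕ) : ℝ) ≤ (P^[k] i + D * n : ℕ) := by push_cast; linarith
  exact_mod_cast h1

/-- A window no longer than the shortest block, starting in block `i`, stays inside blocks `i` and
`i + 1`; two letters therefore determine it. -/
theorem congr_of_pair (h : IsSelfSimilar Y P α c C) (k : ℕ) {i i' : ℕ} (h0 : Y i = Y i')
    (h1 : Y (i + 1) = Y (i' + 1)) {t : ℕ} (ht : P^[k] i + t < P^[k] (i + 2)) :
    P^[k] i' + t < P^[k] (i' + 2) ∧ Y (P^[k] i + t) = Y (P^[k] i' + t) := by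
  refine (h.isBlockMap.iterate k).congr_of_word 2 (fun j hj => ?_) ht
  interval_cases j
  · exact h0
  · exact h1

/-- Linear recurrence of the factors in the prefixes. -/
theorem exists_factor_mem_prefix [Finite B] (h : IsSelfSimilar Y P α c C) :
    ∃ R : ℕ, 0 < R ∧ ∀ m, 0 < m → ∀ i, ∃ q, q + m ≤ R * m ∧ ∀ j < m, Y (i + j) = Y (q + j) := by
  obtain ⟨D, hD⟩ := h.exists_scale
  -- Only finitely many pairs of consecutive letters occur, so each of them already occurs at a
  -- position at most `T`.
  have hpair : ∃ T, ∀ t, ∃ t' ≤ T, Y t = Y t' ∧ Y (t + 1) = Y (t' + 1) := by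
    classical
    have hfin : (Set.range fun t => (Y t, Y (t + 1))).Finite := Set.toFinite _
    choose r hr using fun x : Set.range fun t => (Y t, Y (t + 1)) => x.2
    have : Finite (Set.range fun t => (Y t, Y (t + 1))) := hfin
    obtain ⟨T, hT⟩ := (Set.finite_range r).bddAbove
    refine ⟨T, fun t => ⟨r ⟨_, t, rfl⟩, hT ⟨_, rfl⟩, ?_⟩⟩
    have := hr ⟨_, t, rfl⟩
    simp only [Prod.mk.injEq] at this
    exact ⟨this.1.symm, this.2.symm⟩
  obtain ⟨T, hT⟩ := hpair
  refine ⟨(T + 2) * D + 1, by omega, fun m hm i => ?_⟩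
  obtain ⟨k, hk⟩ := hD m
  obtain ⟨hk1, hk2⟩ := hk hm
  have hb := h.isBlockMap.iterate k
  obtain ⟨t, ht1, ht2⟩ := hb.strictMono.exists_le_lt_succ hb.zero i
  obtain ⟨t', ht', h0, h1⟩ := hT t
  have hlow := h.add_le_of_le hk1 (t + 1)
  have hcong : ∀ j < m, P^[k] t' + (i - P^[k] t + j) < P^[k] (t' + 2) ∧
      Y (i + j) = Y (P^[k] t' + (i - P^[k] t + j)) := fun j hj => by
    have := h.congr_of_pair k h0 h1 (t := i - P^[k] t + j)
      (by rw [show t + 2 = t + 1 + 1 by ring]; omega)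
    rwa [show P^[k] t + (i - P^[k] t + j) = i + j by omega] at this
  have hPle : ∀ n, P^[k] n ≤ n * (D * m) := fun n => by
    induction n with
    | zero => simp [hb.zero]
    | succ n ih =>
      have := h.le_add_of_le hk2 n
      rw [Nat.succ_mul]
      omega
  refine ⟨P^[k] t' + (i - P^[k] t), ?_, fun j hj => ?_⟩
  · have h2 := (hcong (m - 1) (by omega)).1
    have h3 := hPle (t' + 2)
    have h4 : (t' + 2) * (D * m) ≤ (T + 2) * (D * m) := Nat.mul_le_mul_right _ (by omega)
    have h5 : ((T + 2) * D + 1) * m = (T + 2) * (D * m) + m := by ring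
    omega
  · rw [(hcong j hj).2, add_assoc]

/-- The occurrences of a prefix of a sequence which is not periodic are separated by a fixed
proportion of its length. -/
theorem exists_separation [Finite B] (h : IsSelfSimilar Y P α c C) {X : ℕ → A} {φ : B → A}
    (hX : X = φ ∘ Y) (hper : ¬ UltimatelyPeriodic X) :
    ∃ R : ℕ, ∀ n q d, 0 < d → PrefixOccurs X n q → PrefixOccurs X n (q + d) → n < R * d := by
  obtain ⟨R, hR0, hR⟩ := h.exists_factor_mem_prefix
  refine ⟨2 * R, fun n q d hd h1 h2 => ?_⟩
  -- A prefix of length n ≥ 2Rd that reoccurs at distance `d` has period `d`. Being longer than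
  -- R(d+1), it contains every factor of length d+1, so the period extends to all of `X`.
  by_contra! hn
  refine hper ⟨0, d, hd, fun i _ => ?_⟩
  obtain ⟨q', hq', heq⟩ := hR (d + 1) (Nat.succ_pos d) i
  have hle : R * (d + 1) ≤ 2 * R * d := by nlinarith
  have e1 : X (i + d) = X (q' + d) := by simp [hX, heq d (Nat.lt_add_one d)]
  have e2 : X i = X q' := by simpa [hX] using congrArg φ (heq 0 (Nat.succ_pos d))
  have e3 := h1 (q' + d) (by omega)
  have e4 := h2 q' (by omega)
  rw [e1, e2, ← e3, ← e4]
  congr 1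
  ring

open Classical in
/-- A block of length proportional to `n` contains boundedly many occurrences of the prefix of
length `n`. -/
theorem card_filter_prefixOccurs_le {X : ℕ → A} {R D n a len : ℕ} (hn : 0 < n)
    (hR : ∀ q d, 0 < d → PrefixOccurs X n q → PrefixOccurs X n (q + d) → n < R * d)
    (hlen : len ≤ D * n) :
    ((Finset.range len).filter fun s => PrefixOccurs X n (a + s)).card ≤ R * D + 1 := by
  have hkey : ∀ s s', s < s' → PrefixOccurs X n (a + s) → PrefixOccurs X n (a + s') →
      s * R / n < s' * R / n := fun s s' hlt h1 h2 => by
    have h3 := hR (a + s) (s' - s) (by omega) h1 (by rwa [show a + s + (s' - s) = a + s' by omega])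
    have h4 : s * R + n ≤ s' * R := by
      obtain ⟨d, rfl⟩ := Nat.exists_eq_add_of_lt hlt
      rw [show s + d + 1 - s = d + 1 by omega] at h3
      nlinarith
    calc s * R / n < (s * R + n) / n := by rw [Nat.add_div_right _ hn]; omega
      _ ≤ s' * R / n := Nat.div_le_div_right h4
  rw [← Finset.card_range (R * D + 1)]
  -- Occurrences lie more than n/R apart, so ⌊sR/n⌋ separates them, and its values are at most RD.
  refine Finset.card_le_card_of_injOn (fun s => s * R / n) (fun s hs => ?_) fun s hs s' hs' heq => ?_
  · simp only [Finset.coe_filter, Finset.mem_range, Set.mem_ofPred_eq] at hs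
    simp only [Finset.coe_range, Set.mem_Iio]
    rw [Nat.lt_succ_iff]
    refine Nat.div_le_of_le_mul ?_
    calc s * R ≤ D * n * R := Nat.mul_le_mul_right _ (hs.1.le.trans hlen)
      _ = n * (R * D) := by ring
  · simp only [Finset.coe_filter, Finset.mem_range, Set.mem_ofPred_eq] at hs hs'
    rcases lt_trichotomy s s' with hlt | heq' | hgt
    · exact absurd heq (hkey s s' hlt hs.2 hs'.2).ne
    · exact heq'
    · exact absurd heq (hkey s' s hgt hs'.2 hs.2).ne'

theorem prefixCount_add {X : ℕ → A} (n N len : ℕ) [DecidablePred fun s => PrefixOccurs X n (N + s)] :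
    prefixCount X n (N + len) = prefixCount X n N +
      ((Finset.range len).filter fun s => PrefixOccurs X n (N + s)).card := by
  classical
  simp only [prefixCount, Finset.card_filter, Finset.sum_range_add]
  congr!

/-- The density of the prefix of length `n` takes, up to a power of `α` which tends to infinity with
`n`, finitely many values. -/
theorem exists_finite_upperSlope_prefixCount [Finite B] (h : IsSelfSimilar Y P α c C) {X : ℕ → A}
    {φ : B → A} (hX : X = φ ∘ Y) (hper : ¬ UltimatelyPeriodic X) :
    ∃ (S : Set ℝ) (k : ℕ → ℕ), S.Finite ∧ Tendsto k atTop atTop ∧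
      ∀ n, 0 < n → 0 < upperSlope (fun N => prefixCount X n N) ∧
        α ^ k n * upperSlope (fun N => prefixCount X n N) ∈ S := by
  classical
  obtain ⟨D, hD⟩ := h.exists_scale
  obtain ⟨R, hR⟩ := h.exists_separation hX hper
  choose k hk using hD
  set K := R * D + 1
  -- The candidates are the slopes of all bounded counts indexed by pairs of letters; neither the
  -- bound nor the pairs depend on `n`.
  refine ⟨Set.range fun g : B × B → Fin (K + 1) =>
    upperSlope fun N => ∑ i ∈ Finset.range N, ((g (Y i, Y (i + 1)) : ℕ) : ℝ), k,
    Set.finite_range _, ?_, fun n hn => ?_⟩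
  · refine tendsto_atTop.mpr fun b => ?_
    filter_upwards [eventually_gt_atTop ⌈c * α ^ b⌉₊] with n hn
    have h1 := (hk n (by omega)).1
    have h2 := (Nat.lt_of_ceil_lt hn).trans_le h1
    have h3 := lt_of_mul_lt_mul_left h2 h.pos.le
    exact ((pow_lt_pow_iff_right₀ h.one_lt).mp h3).le
  · obtain ⟨hk1, hk2⟩ := hk n hn
    have hb := h.isBlockMap.iterate (k n)
    set Q := P^[k n] with hQ
    set G : ℕ → ℕ := fun i =>
      ((Finset.range (Q (i + 1) - Q i)).filter fun s => PrefixOccurs X n (Q i + s)).card with hG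
    have hGK : ∀ i, G i < K + 1 := fun i => Nat.lt_succ_of_le <|
      card_filter_prefixOccurs_le hn (hR n) (by
        have := h.le_add_of_le hk2 i
        rw [← hQ] at this
        omega)
    have hGcongr : ∀ i i', Y i = Y i' → Y (i + 1) = Y (i' + 1) → G i = G i' := by
      intro i i' h0 h1
      have hlen : Q (i + 1) - Q i = Q (i' + 1) - Q i' := by
        have := hb.add_eq_add h0
        have := hb.lt_succ i
        have := hb.lt_succ i'
        omega
      simp only [hG, ← hlen]
      refine congrArg Finset.card (Finset.filter_congr fun s hs => ?_)
      rw [Finset.mem_range] at hs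
      refine forall₂_congr fun j hj => ?_
      have h2 := h.add_le_of_le hk1 (i + 1)
      rw [← hQ] at h2
      have h3 := (h.congr_of_pair (k n) h0 h1 (t := s + j)
        (by rw [show i + 2 = i + 1 + 1 by ring, ← hQ]; omega)).2
      rw [hX]
      simp only [Function.comp_apply, add_assoc]
      rw [← hQ] at h3
      rw [h3]
    obtain ⟨g, hg⟩ : ∃ g : B × B → Fin (K + 1), ∀ i, (g (Y i, Y (i + 1)) : ℕ) = G i := by
      -- Pairs that never occur in `Y` get the irrelevant value 0.
      refine ⟨fun x => if hx : ∃ i, (Y i, Y (i + 1)) = x then ⟨G hx.choose, hGK _⟩ else 0,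
        fun i => ?_⟩
      have hx : ∃ i', (Y i', Y (i' + 1)) = (Y i, Y (i + 1)) := ⟨i, rfl⟩
      have hc := hx.choose_spec
      rw [Prod.mk.injEq] at hc
      simp only [dif_pos hx]
      exact hGcongr _ _ hc.1 hc.2
    have hcount : ∀ N, prefixCount X n (Q N) = ∑ i ∈ Finset.range N, G i := fun N => by
      induction N with
      | zero => simp [prefixCount, hb.zero]
      | succ N ih =>
        rw [Finset.sum_range_succ, ← ih, hG, ← prefixCount_add,
          Nat.add_sub_cancel' (hb.lt_succ N).le]
    have hf0 : ∀ N, (0 : ℝ) ≤ prefixCount X n N := fun N => Nat.cast_nonneg _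
    have hmono : Monotone fun N => (prefixCount X n N : ℝ) := fun N N' hN =>
      Nat.cast_le.mpr <| Finset.card_le_card <| Finset.filter_subset_filter _ <|
        Finset.range_subset_range.mpr hN
    have h1 : (1 : ℝ) ∈ slopeBounds fun N => (prefixCount X n N : ℝ) := ⟨0, fun N => by
      have : prefixCount X n N ≤ N := by
        simpa [prefixCount] using Finset.card_filter_le (Finset.range N) (PrefixOccurs X n)
      simpa using this⟩
    have hcomp := upperSlope_comp hf0 hmono ⟨1, h1⟩ hb.strictMono hb.zero (h.pow_pos (k n))
      (h.sublinear (k n))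
    have hne : (slopeBounds fun N => (prefixCount X n (Q N) : ℝ)).Nonempty :=
      ⟨_, mul_add_mem_slopeBounds_comp hf0 (h.sublinear (k n)) h1 one_pos⟩
    refine ⟨?_, g, ?_⟩
    -- Each block coming from the letter `Y 0` starts with the prefix of length `n`, so the density
    -- of that letter bounds the count from below.
    · refine pos_of_mul_pos_right (a := α ^ k n) ?_ (h.pow_pos _).le
      rw [← hcomp]
      refine h.recurrent.trans_le (upperSlope_mono hne (fun N => Finset.sum_nonneg fun i _ =>
        Set.indicator_nonneg (fun _ _ => zero_le_one) _) fun N => ?_)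
      rw [hcount]
      push_cast
      refine Finset.sum_le_sum fun i _ => ?_
      by_cases hi : Y i = Y 0
      · rw [Set.indicator_of_mem (by simpa using hi)]
        have hpos : 0 < G i := by
          rw [hG, Finset.card_pos]
          refine ⟨0, Finset.mem_filter.mpr ⟨?_, fun j hj => ?_⟩⟩
          · have := hb.lt_succ i
            rw [Finset.mem_range]
            omega
          · have h2 := h.add_le_of_le hk1 i
            have h3 := (hb.congr i 0 hi j (by rw [hQ]; omega)).2
            rw [hb.zero, zero_add] at h3
            simp [hX, h3]
        rw [Pi.one_apply]
        exact_mod_cast hpos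
      · rw [Set.indicator_of_notMem (by simpa using hi)]
        exact Nat.cast_nonneg _
    · simp only [hg]
      rw [← hcomp]
      congr 1
      ext N
      rw [hcount]
      push_cast
      rfl

end IsSelfSimilar

/-! ### Comparison of the two substitutions -/

theorem Substitution.IsPrimitive.exists_finite_upperSlope_prefixCount {A B : Type*} [Fintype B]
    [DecidableEq B] {τ : Substitution B} (hτ : τ.IsPrimitive) {X : ℕ → A} (hX : ArisesFrom X τ)
    (hper : ¬ UltimatelyPeriodic X) {α : ℝ} (hα : IsDominantEigenvalue τ.matrix α) :
    0 < α ∧ ∃ (S : Set ℝ) (k : ℕ → ℕ), S.Finite ∧ Tendsto k atTop atTop ∧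
      ∀ n, 0 < n → 0 < upperSlope (fun N => prefixCount X n N) ∧
        α ^ k n * upperSlope (fun N => prefixCount X n N) ∈ S := by
  obtain ⟨Y, φ, hY, hφ⟩ := hX
  have : Nontrivial B := by
    by_contra hB
    rw [not_nontrivial_iff_subsingleton] at hB
    exact hper ⟨0, 1, one_pos, fun n _ => by
      simp [hφ, Subsingleton.elim (Y (n + 1)) (Y n)]⟩
  obtain ⟨c, C, h⟩ := hY.isSelfSimilar hτ hα
  exact ⟨zero_lt_one.trans h.one_lt, h.exists_finite_upperSlope_prefixCount hφ hper⟩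

theorem mainTheorem1 {A B C : Type*} [Finite A] [Fintype B] [DecidableEq B] [Fintype C]
    [DecidableEq C] (X : ℕ → A) (τ : Substitution B) (σ : Substitution C)
    (hτ : τ.IsPrimitive) (hσ : σ.IsPrimitive)
    (hXτ : ArisesFrom X τ) (hXσ : ArisesFrom X σ) (hX : ¬ UltimatelyPeriodic X)
    (α β : ℝ) (hα : IsDominantEigenvalue τ.matrix α) (hβ : IsDominantEigenvalue σ.matrix β) :
    MultiplicativelyDependent α β := by
  obtain ⟨hα0, S, k, hS, hk, hF⟩ := hτ.exists_finite_upperSlope_prefixCount hXτ hX hα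
  obtain ⟨hβ0, T, l, hT, hl, hF'⟩ := hσ.exists_finite_upperSlope_prefixCount hXσ hX hβ
  set F : ℕ → ℝ := fun n => upperSlope fun N => prefixCount X n N
  have := hS.to_subtype
  have := hT.to_subtype
  -- The shift to `n + 1` excludes the empty prefix. An infinite fiber is needed so that both
  -- exponents can be made strictly larger within it.
  obtain ⟨⟨s, t⟩, hst⟩ := Finite.exists_infinite_fiber fun n : ℕ =>
    ((⟨_, (hF (n + 1) n.succ_pos).2⟩, ⟨_, (hF' (n + 1) n.succ_pos).2⟩) : S × T)
  rw [Set.infinite_coe_iff] at hst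
  have hfiber : ∀ n ∈ _, _ := fun n (hn : n ∈ (fun n : ℕ =>
    ((⟨_, (hF (n + 1) n.succ_pos).2⟩, ⟨_, (hF' (n + 1) n.succ_pos).2⟩) : S × T)) ⁻¹' {(s, t)}) =>
    Prod.mk.inj hn
  obtain ⟨n, hn⟩ := hst.nonempty
  have hev := ((hk.comp (tendsto_add_atTop_nat 1)).eventually_gt_atTop (k (n + 1))).and
    ((hl.comp (tendsto_add_atTop_nat 1)).eventually_gt_atTop (l (n + 1)))
  obtain ⟨n', hn', hkn, hln⟩ := (((Nat.frequently_atTop_iff_infinite).mpr hst).and_eventually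
    hev).exists
  simp only [Function.comp_apply] at hkn hln
  have hα1 : α ^ k (n + 1) * F (n + 1) = α ^ k (n' + 1) * F (n' + 1) :=
    congrArg Subtype.val ((hfiber n hn).1.trans (hfiber n' hn').1.symm)
  have hβ1 : β ^ l (n + 1) * F (n + 1) = β ^ l (n' + 1) * F (n' + 1) :=
    congrArg Subtype.val ((hfiber n hn).2.trans (hfiber n' hn').2.symm)
  have hF1 := (hF (n' + 1) n'.succ_pos).1
  have key : ∀ {γ : ℝ} {a b : ℕ}, 0 < γ → a < b → γ ^ a * F (n + 1) = γ ^ b * F (n' + 1) →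
      γ ^ (b - a) = F (n + 1) / F (n' + 1) := fun {γ a b} hγ hab heq => by
    rw [eq_div_iff hF1.ne']
    refine mul_left_cancel₀ (pow_pos hγ a).ne' ?_
    rw [← mul_assoc, ← pow_add, Nat.add_sub_cancel' hab.le, heq]
  exact ⟨_, _, Nat.sub_pos_of_lt hkn, Nat.sub_pos_of_lt hln,
    (key hα0 hkn hα1).trans (key hβ0 hln hβ1).symm⟩
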